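/- Let $Q=(Q_0,Q_1)$ be a finite quiver (loops and multiple arrows allowed); the arrow $h\in Q_1$ goes from $h'$ to $h''$. For dimension vectors $v,w\in\mathbb{N}^{Q_0}$ put $$\langle v,w\rangle=\sum_{i\in Q_0}v_iw_i-\sum_{h\in Q_1}v_{h'}w_{h''},\qquad v\cdot v=\sum_{i\in Q_0}v_i^2,$$ $$(v_\bullet)_i=\sum_{h'=i}v_{h''},\qquad ({}_\bullet v)_i=\sum_{h''=i}v_{h'},$$ and let $\ge$ be the componentwise order. In $\mathbb{Q}(t)$ let $gl(s,t)=\prod_{i=0}^{s-1}(t^s-t^i)$ for $s\in\mathbb{N}$, $gl(v,t)=\prod_{i\in Q_0}gl(v_i,t)$, and $$r(v,t)=t^{v\cdot v-\langle v,v\rangle},$$ $$m(v,t)=t^{\langle v,v\rangle}\frac{gl(v_\bullet,t)}{gl(v_\bullet-v,t)}\ \text{ if } v_\bullet\ge v,\qquad m(v,t)=0\ \text{ otherwise},$$ $$e(v,t)=t^{\langle v,v\rangle}\frac{gl({}_\bullet v,t)}{gl({}_\bullet v-v,t)}\ \text{ if } {}_\bullet v\ge v,\qquad e(v,t)=0\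 \text{ otherwise}.$$ For ${}_\bullet v\ge w$ let $$H(v,w,t^{-1})=t^{({}_\bullet v-w)\cdot({}_\bullet v-w)-{}_\bullet v\cdot{}_\bullet v}\,\frac{gl({}_\bullet v,t)}{gl({}_\bullet v-w,t)},$$ and define $n(v,t)\in\mathbb{Q}(t)$ (the Bozec–Schiffmann–Vasserot function) by $$\frac{n(v,t)}{gl(v,t)}=\sum_{v^*}t^{-\sum_{k<l}\langle v^{(k)},v^{(l)}\rangle}\prod_{k=1}^{s}\frac{H(v^{(k)},v^{(k+1)},t^{-1})}{gl(v^{(k)},t)},$$ where the sum is over all finite tuples $v^*=(v^{(1)},\dots,v^{(s)})$, $s\ge 0$, of non-zero dimension vectors such that $\sum_k v^{(k)}=v$ and ${}_\bullet v^{(k)}\ge v^{(k+1)}$ for $1\le k<s$, with the convention $v^{(s+1)}=0$. The completed quantum torus of $Q$ over $\mathbb{Q}(t)$ is the algebra of all formal series $\sum_{v\in\mathbb{N}^{Q_0}}a_vX^v$ with $a_v\in\mathbb{Q}(t)$, multiplied according to $X^v\circ X^w=t^{-\langle v,w\rangle}X^{v+w}$. In this algebra the following two identities hold: $$\sum_{v}\frac{r(v,t)}{gl(v,t)}X^v=\Big(\sum_{v}\frac{m(v,t)}{gl(v,t)}X^v\Big)\circ\Big(\sum_{v}\frac{n(v,t)}{gl(v,t)}X^v\Big),$$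 $$\sum_{v}\frac{r(v,t)}{gl(v,t)}X^v=\Big(\sum_{v}\frac{n(v,t)}{gl(v,t)}X^v\Big)\circ\Big(\sum_{v}\frac{e(v,t)}{gl(v,t)}X^v\Big),$$ where $v$ runs over $\mathbb{N}^{Q_0}$ in every sum. -/

import Mathlib

open Finset CategoryTheory

universe u w

/-! `V` is the vertex set of a finite quiver, `a ⟶ b` its finite set of arrows from `a` to `b`.
Dimension vectors are functions `V → ℕ`. -/

namespace QuiverTorus

noncomputable section

/-- The pairs of dimension vectors with a given sum. -/
instance instHasAntidiagonal {V : Type u} [Fintype V] [DecidableEq V] :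
    HasAntidiagonal (V → ℕ) where
  antidiagonal u := (Iic u ×ˢ Iic u).filter (fun p => p.1 + p.2 = u)
  mem_antidiagonal := by
    intro u p
    simp only [mem_filter, mem_product, mem_Iic, and_iff_right_iff_imp]
    rintro rfl
    exact ⟨le_self_add, le_add_self⟩

/-- The Euler form `⟨v, w⟩ = ∑_i v_i w_i - ∑_h v_{h'} w_{h''}`, where the arrow `h` goes from
`h'` to `h''`. -/
def eulerForm {V : Type u} [Fintype V] [Quiver.{w + 1} V] [∀ a b : V, Fintype (a ⟶ b)]
    (x y : V → ℕ) : ℤ :=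
  ∑ i, (x i : ℤ) * y i - ∑ a, ∑ b, ∑ _h : a ⟶ b, (x a : ℤ) * y b

theorem eulerForm_add_left {V : Type u} [Fintype V] [Quiver.{w + 1} V]
    [∀ a b : V, Fintype (a ⟶ b)] (x y z : V → ℕ) :
    eulerForm (x + y) z = eulerForm x z + eulerForm y z := by
  simp only [eulerForm, Pi.add_apply, Nat.cast_add, add_mul, sum_add_distrib]
  ring

theorem eulerForm_add_right {V : Type u} [Fintype V] [Quiver.{w + 1} V]
    [∀ a b : V, Fintype (a ⟶ b)] (x y z : V → ℕ) :
    eulerForm x (y + z) = eulerForm x y + eulerForm x z := by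
  simp only [eulerForm, Pi.add_apply, Nat.cast_add, mul_add, sum_add_distrib]
  ring

theorem eulerForm_zero_left {V : Type u} [Fintype V] [Quiver.{w + 1} V]
    [∀ a b : V, Fintype (a ⟶ b)] (x : V → ℕ) : eulerForm 0 x = 0 := by simp [eulerForm]

theorem eulerForm_zero_right {V : Type u} [Fintype V] [Quiver.{w + 1} V]
    [∀ a b : V, Fintype (a ⟶ b)] (x : V → ℕ) : eulerForm x 0 = 0 := by simp [eulerForm]

/-- `v_•`: its value at `i` is the sum of `v_{h''}` over the arrows `h` with source `i`. -/
def outDim {V : Type u} [Fintype V] [Quiver.{w + 1} V] [∀ a b : V, Fintype (a ⟶ b)]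
    (v : V → ℕ) : V → ℕ :=
  fun i => ∑ b, ∑ _h : i ⟶ b, v b

/-- `_•v`: its value at `i` is the sum of `v_{h'}` over the arrows `h` with target `i`. -/
def inDim {V : Type u} [Fintype V] [Quiver.{w + 1} V] [∀ a b : V, Fintype (a ⟶ b)]
    (v : V → ℕ) : V → ℕ :=
  fun i => ∑ a, ∑ _h : a ⟶ i, v a

/-- The variable `t` of `ℚ(t)`. -/
abbrev t : RatFunc ℚ := RatFunc.X

theorem t_ne_zero : t ≠ 0 := RatFunc.X_ne_zero

/-- The order polynomial `∏_{i < s} (t^s - t^i)` of the general linear group of rank `s`. -/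
def glNat (s : ℕ) : RatFunc ℚ := ∏ i ∈ range s, (t ^ s - t ^ i)

/-- `gl(v, t) = ∏_i gl(v_i, t)`. -/
def gl {V : Type u} [Fintype V] (v : V → ℕ) : RatFunc ℚ := ∏ i, glNat (v i)

/-- `v · v`. -/
def dotSelf {V : Type u} [Fintype V] (v : V → ℕ) : ℕ := ∑ i, v i ^ 2

/-- `r(v, t) = t^{v·v - ⟨v, v⟩}`. -/
def r {V : Type u} [Fintype V] [Quiver.{w + 1} V] [∀ a b : V, Fintype (a ⟶ b)]
    (v : V → ℕ) : RatFunc ℚ :=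
  t ^ ((dotSelf v : ℤ) - eulerForm v v)

open Classical in
/-- `m(v, t)`. -/
def m {V : Type u} [Fintype V] [Quiver.{w + 1} V] [∀ a b : V, Fintype (a ⟶ b)]
    (v : V → ℕ) : RatFunc ℚ :=
  if v ≤ outDim v then t ^ eulerForm v v * (gl (outDim v) / gl (outDim v - v)) else 0

open Classical in
/-- `e(v, t)`. -/
def e {V : Type u} [Fintype V] [Quiver.{w + 1} V] [∀ a b : V, Fintype (a ⟶ b)]
    (v : V → ℕ) : RatFunc ℚ :=
  if v ≤ inDim v then t ^ eulerForm v v * (gl (inDim v) / gl (inDim v - v)) else 0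

/-- `H(v, w, t⁻¹)`, to be used for `w ≤ _•v`. -/
def H {V : Type u} [Fintype V] [Quiver.{w + 1} V] [∀ a b : V, Fintype (a ⟶ b)]
    (x y : V → ℕ) : RatFunc ℚ :=
  t ^ ((dotSelf (inDim x - y) : ℤ) - (dotSelf (inDim x) : ℤ)) *
    (gl (inDim x) / gl (inDim x - y))

/-- The tuples `(v^{(1)}, v^{(2)}, …)` of non-zero dimension vectors with sum `v` such that
`_•v^{(k)} ≥ v^{(k+1)}` for all `k`; entries beyond the end of the tuple are read as `0`. -/
def tuples {V : Type u} [Fintype V] [Quiver.{w + 1} V] [∀ a b : V, Fintype (a ⟶ b)]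
    (v : V → ℕ) : Set (List (V → ℕ)) :=
  {L | (∀ x ∈ L, x ≠ 0) ∧ L.sum = v ∧ ∀ k, L.getD (k + 1) 0 ≤ inDim (L.getD k 0)}

theorem length_le_of_ne_zero {V : Type u} [Fintype V] (L : List (V → ℕ)) :
    (∀ x ∈ L, x ≠ 0) → L.length ≤ ∑ i, L.sum i := by
  induction L with
  | nil => intro _; simp
  | cons x L ih =>
    intro h
    have h1 := ih (fun y hy => h y (List.mem_cons_of_mem _ hy))
    have h2 : 1 ≤ ∑ i, x i := by
      rw [Nat.one_le_iff_ne_zero]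
      intro h0
      refine h x List.mem_cons_self (funext fun i => ?_)
      simpa using (Finset.sum_eq_zero_iff.mp h0) i (mem_univ i)
    simp only [List.length_cons, List.sum_cons, Pi.add_apply, sum_add_distrib]
    omega

theorem tuples_finite {V : Type u} [Fintype V] [DecidableEq V] [Quiver.{w + 1} V]
    [∀ a b : V, Fintype (a ⟶ b)] (v : V → ℕ) : (tuples v).Finite := by
  refine ((List.finite_length_le {x : V → ℕ // x ∈ Iic v} (∑ i, v i)).image
    (List.map Subtype.val)).subset ?_
  rintro L ⟨h0, hs, -⟩
  have hm : ∀ x ∈ L, x ∈ Iic v := fun x hx => by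
    rw [mem_Iic, ← hs]
    exact List.single_le_sum (fun y _ => zero_le) x hx
  refine ⟨L.attach.map (fun x => ⟨x.1, hm x.1 x.2⟩), ?_, ?_⟩
  · have := length_le_of_ne_zero L h0
    rw [hs] at this
    simpa using this
  · simp [List.map_map, Function.comp_def]

/-- The summand of a tuple `(v^{(1)}, v^{(2)}, …)` in `n(v, t) / gl(v, t)`:
`t^{-∑_{k<l} ⟨v^{(k)}, v^{(l)}⟩} ∏_k H(v^{(k)}, v^{(k+1)}, t⁻¹) / gl(v^{(k)}, t)`. -/
def tupleTerm {V : Type u} [Fintype V] [Quiver.{w + 1} V] [∀ a b : V, Fintype (a ⟶ b)]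
    (L : List (V → ℕ)) : RatFunc ℚ :=
  t ^ (-∑ l ∈ range L.length, ∑ k ∈ range l, eulerForm (L.getD k 0) (L.getD l 0)) *
    ∏ k ∈ range L.length, H (L.getD k 0) (L.getD (k + 1) 0) / gl (L.getD k 0)

/-- `n(v, t)`. -/
def n {V : Type u} [Fintype V] [DecidableEq V] [Quiver.{w + 1} V]
    [∀ a b : V, Fintype (a ⟶ b)] (v : V → ℕ) : RatFunc ℚ :=
  gl v * ∑ L ∈ (tuples_finite v).toFinset, tupleTerm L

/-- The completion of the quantum torus over `ℚ(t)` with respect to its grading by dimension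
vectors: the elements are the formal series `∑_v a_v X^v` over all dimension vectors `v`, that
is, the families `(a_v)_v`; the product, given below, satisfies
`X^v ∘ X^w = t^{-⟨v, w⟩} X^{v+w}`. -/
def CompletedQuantumTorus (V : Type u) [Quiver.{w + 1} V] : Type u := (V → ℕ) → RatFunc ℚ

namespace CompletedQuantumTorus

/-- The formal series `∑_v a_v X^v`. -/
def series {V : Type u} [Quiver.{w + 1} V] (a : (V → ℕ) → RatFunc ℚ) :
    CompletedQuantumTorus V := a

/-- The coefficient of `X^v`. -/
def coeff {V : Type u} [Quiver.{w + 1} V] (f : CompletedQuantumTorus V) (v : V → ℕ) :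
    RatFunc ℚ := f v

instance {V : Type u} [Quiver.{w + 1} V] : AddCommGroup (CompletedQuantumTorus V) :=
  inferInstanceAs (AddCommGroup ((V → ℕ) → RatFunc ℚ))

instance {V : Type u} [Quiver.{w + 1} V] : Module (RatFunc ℚ) (CompletedQuantumTorus V) :=
  inferInstanceAs (Module (RatFunc ℚ) ((V → ℕ) → RatFunc ℚ))

/-- The basis element `X^v`. -/
def X {V : Type u} [Fintype V] [DecidableEq V] [Quiver.{w + 1} V] (v : V → ℕ) :
    CompletedQuantumTorus V :=
  series fun x => if x = v then 1 else 0

/-- The product: the coefficient of `X^u` in `f ∘ g` is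
`∑_{v + w = u} t^{-⟨v, w⟩} f_v g_w`. -/
instance {V : Type u} [Fintype V] [DecidableEq V] [Quiver.{w + 1} V]
    [∀ a b : V, Fintype (a ⟶ b)] : Mul (CompletedQuantumTorus V) where
  mul f g := series fun u => ∑ p ∈ antidiagonal u,
    t ^ (-eulerForm p.1 p.2) * (coeff f p.1 * coeff g p.2)

instance {V : Type u} [Fintype V] [DecidableEq V] [Quiver.{w + 1} V] :
    One (CompletedQuantumTorus V) where
  one := X 0

section Lemmas

variable {V : Type u} [Fintype V] [DecidableEq V] [Quiver.{w + 1} V]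
  [∀ a b : V, Fintype (a ⟶ b)]

theorem coeff_mul (f g : CompletedQuantumTorus V) (x : V → ℕ) :
    coeff (f * g) x = ∑ p ∈ antidiagonal x,
      t ^ (-eulerForm p.1 p.2) * (coeff f p.1 * coeff g p.2) := rfl

/-- The defining relation `X^v ∘ X^w = t^{-⟨v, w⟩} X^{v+w}`. -/
theorem X_mul_X (x y : V → ℕ) :
    (X x * X y : CompletedQuantumTorus V) = t ^ (-eulerForm x y) • X (x + y) := by
  funext z
  change (∑ p ∈ antidiagonal z, t ^ (-eulerForm p.1 p.2) *
    ((if p.1 = x then 1 else 0) * (if p.2 = y then 1 else 0))) =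
    t ^ (-eulerForm x y) * (if z = x + y then 1 else 0)
  by_cases h : z = x + y
  · rw [Finset.sum_eq_single (x, y)]
    · simp [h]
    · rintro ⟨a, b⟩ - hab
      by_cases ha : a = x
      · have hb : b ≠ y := fun hb => hab (by rw [ha, hb])
        simp [hb]
      · simp [ha]
    · intro hn
      exact absurd (HasAntidiagonal.mem_antidiagonal.mpr h.symm) hn
  · rw [if_neg h, mul_zero]
    refine Finset.sum_eq_zero ?_
    rintro ⟨a, b⟩ hab
    by_cases ha : a = x
    · by_cases hb : b = y
      · refine absurd ?_ h
        rw [← ha, ← hb]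
        exact (HasAntidiagonal.mem_antidiagonal.mp hab).symm
      · simp [hb]
    · simp [ha]

protected theorem one_mul (f : CompletedQuantumTorus V) : 1 * f = f := by
  funext z
  change (∑ p ∈ antidiagonal z, t ^ (-eulerForm p.1 p.2) *
    ((if p.1 = 0 then 1 else 0) * f p.2)) = f z
  rw [Finset.sum_eq_single (0, z)]
  · simp [eulerForm_zero_left]
  · rintro ⟨a, b⟩ hab hne
    have ha : a ≠ 0 := by
      rintro rfl
      exact hne (by rw [← HasAntidiagonal.mem_antidiagonal.mp hab]; simp)
    simp [ha]
  · intro hn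
    exact absurd (HasAntidiagonal.mem_antidiagonal.mpr (zero_add z)) hn

protected theorem mul_one (f : CompletedQuantumTorus V) : f * 1 = f := by
  funext z
  change (∑ p ∈ antidiagonal z, t ^ (-eulerForm p.1 p.2) *
    (f p.1 * (if p.2 = 0 then 1 else 0))) = f z
  rw [Finset.sum_eq_single (z, 0)]
  · simp [eulerForm_zero_right]
  · rintro ⟨a, b⟩ hab hne
    have hb : b ≠ 0 := by
      rintro rfl
      exact hne (by rw [← HasAntidiagonal.mem_antidiagonal.mp hab]; simp)
    simp [hb]
  · intro hn
    exact absurd (HasAntidiagonal.mem_antidiagonal.mpr (add_zero z)) hn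

protected theorem mul_assoc (f g h : CompletedQuantumTorus V) : f * g * h = f * (g * h) := by
  funext z
  change (∑ p ∈ antidiagonal z, t ^ (-eulerForm p.1 p.2) *
      ((∑ s ∈ antidiagonal p.1, t ^ (-eulerForm s.1 s.2) * (f s.1 * g s.2)) * h p.2)) =
    ∑ p ∈ antidiagonal z, t ^ (-eulerForm p.1 p.2) *
      (f p.1 * ∑ s ∈ antidiagonal p.2, t ^ (-eulerForm s.1 s.2) * (g s.1 * h s.2))
  simp only [Finset.sum_mul, Finset.mul_sum]
  rw [Finset.sum_sigma', Finset.sum_sigma']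
  refine Finset.sum_nbij' (fun s => ⟨(s.2.1, s.2.2 + s.1.2), (s.2.2, s.1.2)⟩)
    (fun s => ⟨(s.1.1 + s.2.1, s.2.2), (s.1.1, s.2.1)⟩) ?_ ?_ ?_ ?_ ?_
  · rintro ⟨⟨a, b⟩, ⟨c, d⟩⟩ hs
    simp only [mem_sigma, HasAntidiagonal.mem_antidiagonal] at hs ⊢
    refine ⟨?_, trivial⟩
    rw [← add_assoc, hs.2, hs.1]
  · rintro ⟨⟨a, b⟩, ⟨c, d⟩⟩ hs
    simp only [mem_sigma, HasAntidiagonal.mem_antidiagonal] at hs ⊢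
    refine ⟨?_, trivial⟩
    rw [add_assoc, hs.2, hs.1]
  · rintro ⟨⟨a, b⟩, ⟨c, d⟩⟩ hs
    simp only [mem_sigma, HasAntidiagonal.mem_antidiagonal] at hs
    obtain ⟨hs1, rfl⟩ := hs
    rfl
  · rintro ⟨⟨a, b⟩, ⟨c, d⟩⟩ hs
    simp only [mem_sigma, HasAntidiagonal.mem_antidiagonal] at hs
    obtain ⟨hs1, rfl⟩ := hs
    rfl
  · rintro ⟨⟨a, b⟩, ⟨c, d⟩⟩ hs
    simp only [mem_sigma, HasAntidiagonal.mem_antidiagonal] at hs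
    obtain ⟨hs1, rfl⟩ := hs
    simp only [eulerForm_add_left, eulerForm_add_right, neg_add, zpow_add₀ t_ne_zero]
    ring

instance : Ring (CompletedQuantumTorus V) where
  __ := (inferInstance : AddCommGroup (CompletedQuantumTorus V))
  one_mul := CompletedQuantumTorus.one_mul
  mul_one := CompletedQuantumTorus.mul_one
  mul_assoc := CompletedQuantumTorus.mul_assoc
  left_distrib f g h := by
    funext z
    change (∑ p ∈ antidiagonal z, t ^ (-eulerForm p.1 p.2) * (f p.1 * (g p.2 + h p.2))) =
      (∑ p ∈ antidiagonal z, t ^ (-eulerForm p.1 p.2) * (f p.1 * g p.2)) +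
      ∑ p ∈ antidiagonal z, t ^ (-eulerForm p.1 p.2) * (f p.1 * h p.2)
    rw [← sum_add_distrib]
    exact sum_congr rfl fun _ _ => by ring
  right_distrib f g h := by
    funext z
    change (∑ p ∈ antidiagonal z, t ^ (-eulerForm p.1 p.2) * ((f p.1 + g p.1) * h p.2)) =
      (∑ p ∈ antidiagonal z, t ^ (-eulerForm p.1 p.2) * (f p.1 * h p.2)) +
      ∑ p ∈ antidiagonal z, t ^ (-eulerForm p.1 p.2) * (g p.1 * h p.2)
    rw [← sum_add_distrib]
    exact sum_congr rfl fun _ _ => by ring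
  zero_mul f := by
    funext z
    change (∑ p ∈ antidiagonal z, t ^ (-eulerForm p.1 p.2) * (0 * f p.2)) = 0
    simp
  mul_zero f := by
    funext z
    change (∑ p ∈ antidiagonal z, t ^ (-eulerForm p.1 p.2) * (f p.1 * 0)) = 0
    simp

instance : Algebra (RatFunc ℚ) (CompletedQuantumTorus V) :=
  Algebra.ofModule
    (fun c f g => by
      funext z
      change (∑ p ∈ antidiagonal z, t ^ (-eulerForm p.1 p.2) * ((c * f p.1) * g p.2)) =
        c * ∑ p ∈ antidiagonal z, t ^ (-eulerForm p.1 p.2) * (f p.1 * g p.2)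
      rw [mul_sum]
      exact sum_congr rfl fun _ _ => by ring)
    (fun c f g => by
      funext z
      change (∑ p ∈ antidiagonal z, t ^ (-eulerForm p.1 p.2) * (f p.1 * (c * g p.2))) =
        c * ∑ p ∈ antidiagonal z, t ^ (-eulerForm p.1 p.2) * (f p.1 * g p.2)
      rw [mul_sum]
      exact sum_congr rfl fun _ _ => by ring)

end Lemmas

end CompletedQuantumTorus

end

end QuiverTorus

/-!
Write `R`, `M`, `N`, `E` for the series with coefficients `r/gl`, `m/gl`, `n/gl`, `e/gl`. Over a
finite field with `t` elements, `r(v, t)` counts all representations of dimension `v`, while `m` and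
`e` count those whose structure maps `M_i → ⨁_{h' = i} M_{h''}` are injective, respectively
`⨁_{h'' = i} M_{h'} → M_i` surjective, at every vertex.

Both identities follow from the single explicit series
`S = ∑_v ∏_i (-1)^{v_i} t^{v_i (v_i - 1) / 2} / gl(v, t) X^v` (`invSeries`) and the three facts
`R ∘ S = M`, `S ∘ R = E` and `N ∘ S = S ∘ N = 1`: indeed `R = R ∘ S ∘ N = M ∘ N` and
`R = N ∘ S ∘ R = N ∘ E`. All three rest on the `q`-Vandermonde identity for the products
`∏_{i < b} (x - z t^i)`, taken vertex by vertex (`vecPoch_vandermonde`); the form `⟨v, w⟩` differs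
from `∑_i v_i w_i` by `∑_i (_•v)_i w_i = ∑_i v_i (w_•)_i`, which only rescales the variables in that
identity. The first two facts are direct applications (`series_r_mul_invSeries`,
`invSeries_mul_series_r`).

For `N ∘ S = 1`, split `N = ∑_x N_x` according to the first entry `x` of the tuples (`headSeries`).
Removing the first entry expresses `N_x` through the `N_y` with `y ≤ _•x` (`headSeries_eq`), and by
induction on the degree `N_x ∘ S` has coefficient `t^{-x·v} S_v / gl(x, t)` at `X^{x+v}`
(`coeff_headSeries_mul_invSeries`); here `H(x, y, t⁻¹)` is, up to a power of `t`, again a product of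
the above type. Summing over `x` gives `1` (`series_n_mul_invSeries`). Finally `1 - S ∘ N` is an
idempotent without constant term, hence zero, so `S ∘ N = 1` as well (`mul_eq_one_symm`).
-/

namespace QuiverTorus

noncomputable section

/-! ### The `q`-Vandermonde identity -/

/-- The homogeneous `t`-Pochhammer product `∏_{i < b} (x - z t^i)`. For `x = t^a` and `z = 1` it
counts the surjections from a space of dimension `a` onto one of dimension `b` over a finite field
with `t` elements. -/
def poch (b : ℕ) (x z : RatFunc ℚ) : RatFunc ℚ := ∏ i ∈ range b, (x - z * t ^ i)

@[simp] theorem poch_zero (x z : RatFunc ℚ) : poch 0 x z = 1 := by simp [poch]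

theorem poch_succ (b : ℕ) (x z : RatFunc ℚ) :
    poch (b + 1) x z = poch b x z * (x - z * t ^ b) := by simp [poch, prod_range_succ]

theorem poch_zero_right (b : ℕ) (x : RatFunc ℚ) : poch b x 0 = x ^ b := by simp [poch]

theorem poch_mul_mul (b : ℕ) (c x z : RatFunc ℚ) :
    poch b (c * x) (c * z) = c ^ b * poch b x z := by
  induction b with
  | zero => simp
  | succ b ih => rw [poch_succ, poch_succ, ih]; ring

theorem t_pow_injective : Function.Injective fun k : ℕ => t ^ k := by
  intro a b h
  simp only [t, ← RatFunc.algebraMap_X, ← map_pow] at h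
  have h1 := RatFunc.algebraMap_injective ℚ h
  simpa using congrArg Polynomial.natDegree h1

theorem poch_t_pow_ne_zero {a b : ℕ} (h : b ≤ a) : poch b (t ^ a) 1 ≠ 0 := by
  refine prod_ne_zero_iff.mpr fun i hi => ?_
  rw [one_mul, sub_ne_zero]
  exact fun h1 => ((mem_range.mp hi).trans_le h).ne' (t_pow_injective h1)

theorem poch_t_pow_eq_zero {a b : ℕ} (h : a < b) : poch b (t ^ a) 1 = 0 :=
  prod_eq_zero (mem_range.mpr h) (by simp)

theorem glNat_eq_poch (s : ℕ) : glNat s = poch s (t ^ s) 1 := by simp [glNat, poch]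

theorem glNat_ne_zero (s : ℕ) : glNat s ≠ 0 := by
  rw [glNat_eq_poch]
  exact poch_t_pow_ne_zero le_rfl

@[simp] theorem glNat_zero : glNat 0 = 1 := by simp [glNat]

theorem glNat_succ (s : ℕ) : glNat (s + 1) = glNat s * (t ^ s * (t ^ (s + 1) - 1)) := by
  have h : glNat (s + 1) = (∏ i ∈ range s, t * (t ^ s - t ^ i)) * (t ^ (s + 1) - 1) := by
    rw [glNat, prod_range_succ', pow_zero]
    congr 1
    exact prod_congr rfl fun i _ => by ring
  rw [h, prod_mul_distrib, prod_const, card_range, glNat]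
  ring

/-- The `q`-Vandermonde identity, divided by `gl(b, t)`: the factor
`gl(b, t) t^{-kl} / (gl(k, t) gl(l, t))` that would otherwise appear is a Gaussian binomial
coefficient. -/
theorem poch_vandermonde (b : ℕ) (x y z : RatFunc ℚ) :
    ∑ p ∈ antidiagonal b, (t ^ (p.1 * p.2))⁻¹ *
      (poch p.1 y z / glNat p.1 * (poch p.2 x y / glNat p.2)) = poch b x z / glNat b := by
  induction b with
  | zero => simp
  | succ b ih =>
    set f : ℕ × ℕ → RatFunc ℚ := fun p => (t ^ (p.1 * p.2))⁻¹ *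
      (poch p.1 y z / glNat p.1 * (poch p.2 x y / glNat p.2)) with hf
    have ht (k : ℕ) : t ^ k ≠ 0 := pow_ne_zero _ t_ne_zero
    have hs (k : ℕ) : t ^ (k + 1) - 1 ≠ 0 := fun h => by
      have := glNat_ne_zero (k + 1)
      simp [glNat_succ, h] at this
    -- `x - z t^b = (x - y t^l) + t^l (y - z t^k)` raises either the second or the first index.
    have key : ∀ p ∈ antidiagonal b, f p * (x - z * t ^ b) =
        f (p.1, p.2 + 1) * (t ^ b * (t ^ (p.2 + 1) - 1)) +
          f (p.1 + 1, p.2) * (t ^ b * (t ^ p.2 * (t ^ (p.1 + 1) - 1))) := by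
      rintro ⟨k, l⟩ hp
      obtain rfl : k + l = b := mem_antidiagonal.mp hp
      have h1 := glNat_ne_zero k
      have h2 := glNat_ne_zero l
      have h3 := hs k
      have h4 := hs l
      simp only [hf, poch_succ, glNat_succ]
      have e1 : t ^ (k * (l + 1)) = t ^ (k * l) * t ^ k := by ring
      have e2 : t ^ ((k + 1) * l) = t ^ (k * l) * t ^ l := by ring
      rw [e1, e2, pow_add t k l]
      have h5 := ht k
      have h6 := ht l
      have h7 := ht (k * l)
      generalize t ^ (k + 1) - 1 = A at *
      generalize t ^ (l + 1) - 1 = B at *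
      generalize t ^ (k * l) = C at *
      generalize t ^ k = D at *
      generalize t ^ l = F at *
      field_simp
      ring
    have e1 := Finset.Nat.sum_antidiagonal_succ' (n := b)
      (f := fun p => f p * (t ^ b * (t ^ p.2 - 1)))
    have e2 := Finset.Nat.sum_antidiagonal_succ (n := b)
      (f := fun p => f p * (t ^ b * (t ^ p.2 * (t ^ p.1 - 1))))
    simp only [pow_zero, sub_self, mul_zero, zero_add] at e1 e2
    have hsum : (∑ p ∈ antidiagonal (b + 1), f p) * (t ^ b * (t ^ (b + 1) - 1)) =
        (∑ p ∈ antidiagonal b, f p) * (x - z * t ^ b) := by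
      rw [sum_mul, sum_mul, sum_congr rfl key, sum_add_distrib]
      rw [← e2]
      rw [← e1, ← sum_add_distrib]
      refine sum_congr rfl fun p hp => ?_
      rw [← mem_antidiagonal.mp hp]
      ring
    have hne : t ^ b * (t ^ (b + 1) - 1) ≠ 0 := mul_ne_zero (ht b) (hs b)
    rw [← mul_left_inj' hne, hsum, ih, poch_succ, glNat_succ]
    have := glNat_ne_zero b
    have := hs b
    have := ht b
    field_simp

/-- The number of surjections in terms of orders of general linear groups. -/
theorem glNat_div_glNat_sub {a b : ℕ} (h : b ≤ a) :
    glNat a / glNat (a - b) = t ^ (b * (a - b)) * poch b (t ^ a) 1 := by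
  obtain ⟨c, rfl⟩ := Nat.exists_eq_add_of_le h
  rw [Nat.add_sub_cancel_left, div_eq_iff (glNat_ne_zero c), glNat_eq_poch (b + c), poch,
    prod_range_add, poch]
  have : ∏ i ∈ range c, (t ^ (b + c) - 1 * t ^ (b + i)) = t ^ (b * c) * glNat c := by
    have hc : t ^ (b * c) = ∏ _i ∈ range c, t ^ b := by simp [pow_mul]
    rw [glNat, hc, ← prod_mul_distrib]
    exact prod_congr rfl fun i _ => by ring
  rw [this]
  ring

/-! ### Products over the vertices -/

section Vertices

variable {V : Type u} [Fintype V]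

/-- The product over the vertices of the `t`-Pochhammer products, divided by `gl(v, t)`. -/
def vecPoch (v : V → ℕ) (x z : V → RatFunc ℚ) : RatFunc ℚ :=
  ∏ i, poch (v i) (x i) (z i) / glNat (v i)

theorem gl_ne_zero (v : V → ℕ) : gl v ≠ 0 := prod_ne_zero_iff.mpr fun i _ => glNat_ne_zero (v i)

@[simp] theorem gl_zero : gl (0 : V → ℕ) = 1 := by simp [gl]

@[simp] theorem vecPoch_zero (x z : V → RatFunc ℚ) : vecPoch 0 x z = 1 := by simp [vecPoch]

theorem t_pow_dotProduct (x y : V → ℕ) : t ^ (x ⬝ᵥ y) = ∏ i, t ^ (x i * y i) := by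
  rw [dotProduct, prod_pow_eq_pow_sum]

theorem vecPoch_t_pow_zero (v a : V → ℕ) :
    vecPoch v (fun i => t ^ a i) 0 = t ^ (a ⬝ᵥ v) / gl v := by
  simp [vecPoch, poch_zero_right, t_pow_dotProduct, gl, prod_div_distrib, pow_mul]

theorem vecPoch_one_zero (v : V → ℕ) : vecPoch v 1 0 = (gl v)⁻¹ := by
  simp [vecPoch, poch_zero_right, gl]

theorem vecPoch_zero_zero [DecidableEq V] (v : V → ℕ) :
    vecPoch v 0 0 = if v = 0 then 1 else 0 := by
  split_ifs with h
  · simp [h]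
  · obtain ⟨i, hi⟩ := Function.ne_iff.mp h
    refine prod_eq_zero (mem_univ i) ?_
    simp only [Pi.zero_apply] at hi
    simp [poch_zero_right, hi]

theorem vecPoch_mul_mul (v a : V → ℕ) (x z : V → RatFunc ℚ) :
    vecPoch v (fun i => t ^ a i * x i) (fun i => t ^ a i * z i) =
      t ^ (a ⬝ᵥ v) * vecPoch v x z := by
  rw [vecPoch, vecPoch, t_pow_dotProduct, ← prod_mul_distrib]
  exact prod_congr rfl fun i _ => by rw [poch_mul_mul, pow_mul, mul_div_assoc]

/-- Summation over the splittings `v + w = u` is independent at the different vertices. -/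
theorem sum_antidiagonal_prod [DecidableEq V] (f : V → ℕ × ℕ → RatFunc ℚ) (x : V → ℕ) :
    ∑ p ∈ antidiagonal x, ∏ i, f i (p.1 i, p.2 i) =
      ∏ i, ∑ p ∈ antidiagonal (x i), f i p := by
  rw [prod_univ_sum]
  refine sum_nbij' (fun p i => (p.1 i, p.2 i)) (fun g => (fun i => (g i).1, fun i => (g i).2))
    ?_ ?_ ?_ ?_ ?_
  · intro p hp
    rw [HasAntidiagonal.mem_antidiagonal] at hp
    simp [← hp]
  · intro g hg
    rw [HasAntidiagonal.mem_antidiagonal]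
    funext i
    exact HasAntidiagonal.mem_antidiagonal.mp (Fintype.mem_piFinset.mp hg i)
  · intro p _
    rfl
  · intro g _
    rfl
  · intro p _
    rfl

theorem vecPoch_vandermonde [DecidableEq V] (v : V → ℕ) (x y z : V → RatFunc ℚ) :
    ∑ p ∈ antidiagonal v, (t ^ (p.1 ⬝ᵥ p.2))⁻¹ * (vecPoch p.1 y z * vecPoch p.2 x y) =
      vecPoch v x z := by
  rw [vecPoch, ← prod_congr rfl fun i _ => poch_vandermonde (v i) (x i) (y i) (z i),
    ← sum_antidiagonal_prod]
  refine sum_congr rfl fun p _ => ?_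
  simp only [prod_mul_distrib, prod_inv_distrib, t_pow_dotProduct, vecPoch]

theorem vecPoch_vandermonde_swap [DecidableEq V] (v : V → ℕ) (x y z : V → RatFunc ℚ) :
    ∑ p ∈ antidiagonal v, (t ^ (p.1 ⬝ᵥ p.2))⁻¹ * (vecPoch p.1 x y * vecPoch p.2 y z) =
      vecPoch v x z := by
  rw [← vecPoch_vandermonde v x y z]
  have h : ∀ p ∈ antidiagonal v, p.swap ∈ antidiagonal v := by
    intro p hp
    rw [HasAntidiagonal.mem_antidiagonal] at hp ⊢
    rw [← hp, Prod.fst_swap, Prod.snd_swap, add_comm]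
  refine sum_nbij' Prod.swap Prod.swap h h (fun p _ => p.swap_swap) (fun p _ => p.swap_swap) ?_
  intro p _
  rw [Prod.fst_swap, Prod.snd_swap, dotProduct_comm p.1, mul_comm (vecPoch p.1 x y)]

theorem sum_Iic_eq_sum_antidiagonal [DecidableEq V] (f : (V → ℕ) → RatFunc ℚ) (v : V → ℕ) :
    ∑ x ∈ Iic v, f x = ∑ p ∈ antidiagonal v, f p.1 := by
  refine sum_nbij' (fun x => (x, v - x)) Prod.fst ?_ ?_ ?_ ?_ ?_
  · intro x hx
    rw [HasAntidiagonal.mem_antidiagonal]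
    exact add_tsub_cancel_of_le (mem_Iic.mp hx)
  · intro p hp
    rw [HasAntidiagonal.mem_antidiagonal] at hp
    rw [mem_Iic, ← hp]
    exact le_self_add
  · intro x _
    rfl
  · intro p hp
    rw [HasAntidiagonal.mem_antidiagonal] at hp
    rw [← hp, add_tsub_cancel_left]
  · intro x _
    rfl

theorem gl_div_gl_sub {a v : V → ℕ} (h : v ≤ a) :
    gl a / gl (a - v) = t ^ (v ⬝ᵥ (a - v)) * (gl v * vecPoch v (fun i => t ^ a i) 1) := by
  simp only [gl, vecPoch, t_pow_dotProduct, ← prod_div_distrib, ← prod_mul_distrib]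
  refine prod_congr rfl fun i _ => ?_
  have := glNat_ne_zero (v i)
  rw [Pi.sub_apply, glNat_div_glNat_sub (h i), Pi.one_apply]
  field_simp

theorem vecPoch_eq_zero_of_not_le {a v : V → ℕ} (h : ¬ v ≤ a) :
    vecPoch v (fun i => t ^ a i) 1 = 0 := by
  obtain ⟨i, hi⟩ := not_forall.mp h
  exact prod_eq_zero (mem_univ i) (by simp [poch_t_pow_eq_zero (not_le.mp hi)])

theorem dotSelf_eq (v : V → ℕ) : dotSelf v = v ⬝ᵥ v := by simp [dotSelf, dotProduct, sq]

/-- The number of surjections `a → v`, at every vertex, in terms of general linear groups. -/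
theorem zpow_mul_gl_div_gl_sub {a v : V → ℕ} (h : v ≤ a) :
    t ^ (((v ⬝ᵥ v : ℕ) : ℤ) - (a ⬝ᵥ v : ℕ)) * (gl a / gl (a - v)) =
      gl v * vecPoch v (fun i => t ^ a i) 1 := by
  have h1 : a ⬝ᵥ v = v ⬝ᵥ (a - v) + v ⬝ᵥ v := by
    rw [← dotProduct_add, tsub_add_cancel_of_le h, dotProduct_comm]
  rw [gl_div_gl_sub h, ← mul_assoc, ← zpow_natCast, ← zpow_add₀ t_ne_zero, h1]
  simp

variable [Quiver.{w + 1} V] [∀ a b : V, Fintype (a ⟶ b)]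

theorem inDim_add (x y : V → ℕ) : inDim (x + y) = inDim x + inDim y := by
  funext i
  simp [inDim, sum_add_distrib, mul_add]

theorem outDim_add (x y : V → ℕ) : outDim (x + y) = outDim x + outDim y := by
  funext i
  simp [outDim, sum_add_distrib, mul_add]

theorem eulerForm_eq_inDim (x y : V → ℕ) :
    eulerForm x y = ((x ⬝ᵥ y : ℕ) : ℤ) - (inDim x ⬝ᵥ y : ℕ) := by
  simp only [eulerForm, dotProduct, inDim, Nat.cast_sum, Nat.cast_mul, sum_mul]
  rw [sum_comm (f := fun a b => ∑ _h : a ⟶ b, (x a : ℤ) * y b)]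

theorem eulerForm_eq_outDim (x y : V → ℕ) :
    eulerForm x y = ((x ⬝ᵥ y : ℕ) : ℤ) - (outDim y ⬝ᵥ x : ℕ) := by
  simp only [eulerForm, dotProduct, outDim, Nat.cast_sum, Nat.cast_mul, sum_mul]
  simp only [mul_comm]

theorem t_zpow_neg_eulerForm_inDim (x y : V → ℕ) :
    t ^ (-eulerForm x y) = (t ^ (x ⬝ᵥ y))⁻¹ * t ^ (inDim x ⬝ᵥ y) := by
  rw [eulerForm_eq_inDim, neg_sub, sub_eq_neg_add, zpow_add₀ t_ne_zero, zpow_neg, zpow_natCast,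
    zpow_natCast]

theorem t_zpow_neg_eulerForm_outDim (x y : V → ℕ) :
    t ^ (-eulerForm x y) = (t ^ (x ⬝ᵥ y))⁻¹ * t ^ (outDim y ⬝ᵥ x) := by
  rw [eulerForm_eq_outDim, neg_sub, sub_eq_neg_add, zpow_add₀ t_ne_zero, zpow_neg, zpow_natCast,
    zpow_natCast]

theorem r_div_gl_eq_inDim (v : V → ℕ) : r v / gl v = t ^ (inDim v ⬝ᵥ v) / gl v := by
  rw [r, dotSelf_eq, eulerForm_eq_inDim, sub_sub_cancel, zpow_natCast]

theorem r_div_gl_eq_outDim (v : V → ℕ) : r v / gl v = t ^ (outDim v ⬝ᵥ v) / gl v := by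
  rw [r, dotSelf_eq, eulerForm_eq_outDim, sub_sub_cancel, zpow_natCast]

theorem m_div_gl (v : V → ℕ) : m v / gl v = vecPoch v (fun i => t ^ outDim v i) 1 := by
  have := gl_ne_zero v
  rw [m]
  split_ifs with h
  · rw [eulerForm_eq_outDim, zpow_mul_gl_div_gl_sub h]
    field_simp
  · rw [vecPoch_eq_zero_of_not_le h, zero_div]

theorem e_div_gl (v : V → ℕ) : e v / gl v = vecPoch v (fun i => t ^ inDim v i) 1 := by
  have := gl_ne_zero v
  rw [e]
  split_ifs with h
  · rw [eulerForm_eq_inDim, zpow_mul_gl_div_gl_sub h]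
    field_simp
  · rw [vecPoch_eq_zero_of_not_le h, zero_div]

/-- `H(x, y, t⁻¹)`, extended by zero to all pairs `x, y`. -/
def extH (x y : V → ℕ) : RatFunc ℚ :=
  (t ^ (inDim x ⬝ᵥ y))⁻¹ * (gl y * vecPoch y (fun i => t ^ inDim x i) 1)

theorem extH_of_le {x y : V → ℕ} (h : y ≤ inDim x) : extH x y = H x y := by
  rw [extH, H, ← zpow_mul_gl_div_gl_sub h, ← mul_assoc, ← zpow_natCast, ← zpow_neg,
    ← zpow_add₀ t_ne_zero, dotSelf_eq, dotSelf_eq]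
  congr 2
  obtain ⟨c, hc⟩ := exists_add_of_le h
  rw [hc, add_tsub_cancel_left]
  simp only [add_dotProduct, dotProduct_add, dotProduct_comm c y]
  push_cast
  ring

theorem extH_eq_zero_of_not_le {x y : V → ℕ} (h : ¬ y ≤ inDim x) : extH x y = 0 := by
  rw [extH, vecPoch_eq_zero_of_not_le h, mul_zero, mul_zero]

end Vertices

open CompletedQuantumTorus

/-! ### Tuples of dimension vectors -/

theorem getD_zero_le_sum {V : Type u} (L : List (V → ℕ)) : L.getD 0 0 ≤ L.sum := by
  cases L with
  | nil => simp
  | cons x L => simp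

section Tuples

variable {V : Type u} [Fintype V] [Quiver.{w + 1} V] [∀ a b : V, Fintype (a ⟶ b)]

theorem sum_eulerForm_getD (x : V → ℕ) (L : List (V → ℕ)) :
    ∑ l ∈ range L.length, eulerForm x (L.getD l 0) = eulerForm x L.sum := by
  induction L with
  | nil => simp [eulerForm_zero_right]
  | cons y L ih =>
    rw [List.length_cons, sum_range_succ', List.sum_cons, eulerForm_add_right, ← ih, add_comm]
    simp

theorem tupleTerm_nil : tupleTerm ([] : List (V → ℕ)) = 1 := by simp [tupleTerm]

theorem tupleTerm_cons (x : V → ℕ) (L : List (V → ℕ)) :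
    tupleTerm (x :: L) =
      (gl x)⁻¹ * (t ^ (-eulerForm x L.sum) * (H x (L.getD 0 0) * tupleTerm L)) := by
  rw [tupleTerm, tupleTerm, List.length_cons, sum_range_succ', prod_range_succ']
  simp only [sum_range_succ', List.getD_cons_succ, List.getD_cons_zero, sum_add_distrib,
    sum_eulerForm_getD, range_zero, sum_empty, add_zero, neg_add, zpow_add₀ t_ne_zero]
  ring

theorem cons_mem_tuples_iff {x v : V → ℕ} {L : List (V → ℕ)} :
    x :: L ∈ tuples v ↔ x ≠ 0 ∧ x + L.sum = v ∧ L.getD 0 0 ≤ inDim x ∧ L ∈ tuples L.sum := by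
  simp only [tuples, Set.mem_ofPred_eq, List.forall_mem_cons, List.sum_cons, true_and]
  constructor
  · rintro ⟨⟨hx, h0⟩, hs, h⟩
    exact ⟨hx, hs, h 0, h0, fun k => h (k + 1)⟩
  · rintro ⟨hx, hs, h1, h0, h⟩
    refine ⟨⟨hx, h0⟩, hs, fun k => ?_⟩
    cases k with
    | zero => exact h1
    | succ k => exact h k

theorem sum_of_mem_tuples {v : V → ℕ} {L : List (V → ℕ)} (h : L ∈ tuples v) : L.sum = v := h.2.1

theorem eq_nil_of_getD_zero_eq_zero {v : V → ℕ} {L : List (V → ℕ)} (h : L ∈ tuples v)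
    (h0 : L.getD 0 0 = 0) : L = [] := by
  cases L with
  | nil => rfl
  | cons x L => exact absurd h0 (cons_mem_tuples_iff.mp h).1

theorem nil_mem_tuples : ([] : List (V → ℕ)) ∈ tuples 0 := by
  simp [tuples]

end Tuples

/-! ### Coefficients in the completed quantum torus -/

section Torus

variable {V : Type u} [Quiver.{w + 1} V]

theorem coeff_series (a : (V → ℕ) → RatFunc ℚ) (v : V → ℕ) :
    coeff (series a : CompletedQuantumTorus V) v = a v := rfl

theorem coeff_ext {f g : CompletedQuantumTorus V} (h : ∀ v, coeff f v = coeff g v) : f = g :=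
  funext h

theorem coeff_smul (c : RatFunc ℚ) (f : CompletedQuantumTorus V) (v : V → ℕ) :
    coeff (c • f) v = c * coeff f v := rfl

theorem coeff_sum {ι : Type*} (s : Finset ι) (f : ι → CompletedQuantumTorus V) (v : V → ℕ) :
    coeff (∑ i ∈ s, f i) v = ∑ i ∈ s, coeff (f i) v :=
  Finset.sum_apply v s f

theorem coeff_one [Fintype V] [DecidableEq V] (v : V → ℕ) :
    coeff (1 : CompletedQuantumTorus V) v = if v = 0 then 1 else 0 := rfl

variable [Fintype V] [DecidableEq V] [∀ a b : V, Fintype (a ⟶ b)]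

theorem coeff_X_mul_add (f : CompletedQuantumTorus V) (x y : V → ℕ) :
    coeff (X x * f) (x + y) = t ^ (-eulerForm x y) * coeff f y := by
  rw [coeff_mul, sum_eq_single (x, y)]
  · simp [X, coeff_series]
  · rintro ⟨a, b⟩ hab hne
    rw [HasAntidiagonal.mem_antidiagonal] at hab
    have ha : a ≠ x := by
      rintro rfl
      have hb : b = y := add_left_cancel hab
      exact hne (by rw [hb])
    simp [X, coeff_series, ha]
  · intro h
    rw [HasAntidiagonal.mem_antidiagonal] at h
    exact absurd rfl h

theorem coeff_X_mul_of_not_le (f : CompletedQuantumTorus V) {x v : V → ℕ} (h : ¬ x ≤ v) :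
    coeff (X x * f) v = 0 := by
  rw [coeff_mul]
  refine sum_eq_zero fun p hp => ?_
  have hne : p.1 ≠ x := by
    intro hx
    rw [HasAntidiagonal.mem_antidiagonal, hx] at hp
    rw [← hp] at h
    exact h le_self_add
  simp [X, coeff_series, hne]

/-- An idempotent without constant term vanishes. -/
theorem eq_zero_of_isIdempotentElem {f : CompletedQuantumTorus V} (hf : IsIdempotentElem f)
    (h0 : coeff f 0 = 0) : f = 0 := by
  refine coeff_ext fun v => ?_
  change coeff f v = 0
  induction v using WellFoundedLT.induction with
  | ind v ih =>
    rw [← hf.eq, coeff_mul]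
    refine sum_eq_zero fun p hp => ?_
    rw [HasAntidiagonal.mem_antidiagonal] at hp
    by_cases h : p.1 = v
    · have h2 : p.2 = 0 := by simpa [h] using hp
      rw [h2, h0, mul_zero, mul_zero]
    · have hle : p.1 ≤ v := by
        rw [← hp]
        exact le_self_add
      have h1 : coeff f p.1 = 0 := ih p.1 (lt_of_le_of_ne hle h)
      rw [h1, zero_mul, mul_zero]

/-- One-sided inverses of series with constant term `1` are two-sided: if `f * g = 1`, then
`1 - g * f` is idempotent and has no constant term. -/
theorem mul_eq_one_symm {f g : CompletedQuantumTorus V} (h : f * g = 1)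
    (hf : coeff f 0 = 1) (hg : coeff g 0 = 1) : g * f = 1 := by
  have hid : IsIdempotentElem (g * f) := by
    rw [IsIdempotentElem, mul_assoc, ← mul_assoc f, h, one_mul]
  have h0 : coeff (1 - g * f) 0 = 0 := by
    change coeff (1 : CompletedQuantumTorus V) 0 - coeff (g * f) 0 = 0
    have ha : antidiagonal (0 : V → ℕ) = {(0, 0)} := by
      ext p
      rw [HasAntidiagonal.mem_antidiagonal, mem_singleton, Prod.ext_iff]
      exact add_eq_zero
    rw [coeff_one, if_pos rfl, coeff_mul, ha]
    simp [hf, hg, eulerForm_zero_left]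
  exact (sub_eq_zero.mp (eq_zero_of_isIdempotentElem hid.one_sub h0)).symm

/-! ### The inverse of the series of the Bozec–Schiffmann–Vasserot functions -/

variable (V) in
/-- The series `∑_v ∏_i (-1)^{v_i} t^{v_i (v_i - 1) / 2} / gl(v, t) X^v`. -/
def invSeries : CompletedQuantumTorus V := series fun v => vecPoch v 0 1

/-- The `q`-Vandermonde identity with middle variable `0`, where one factor becomes a power of
`t`. -/
theorem series_r_mul_invSeries :
    (series fun v : V → ℕ => r v / gl v) * invSeries V =
      series fun v : V → ℕ => m v / gl v := by
  refine coeff_ext fun v => ?_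
  rw [coeff_mul, coeff_series, m_div_gl, ← vecPoch_vandermonde_swap v _ 0]
  refine sum_congr rfl fun p hp => ?_
  rw [HasAntidiagonal.mem_antidiagonal] at hp
  rw [vecPoch_t_pow_zero, ← hp, outDim_add, add_dotProduct, pow_add,
    t_zpow_neg_eulerForm_outDim, coeff_series, r_div_gl_eq_outDim, invSeries, coeff_series]
  ring

/-- The `q`-Vandermonde identity with middle variable `0`, where one factor becomes a power of
`t`. -/
theorem invSeries_mul_series_r :
    invSeries V * (series fun v : V → ℕ => r v / gl v) =
      series fun v : V → ℕ => e v / gl v := by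
  refine coeff_ext fun v => ?_
  rw [coeff_mul, coeff_series, e_div_gl, ← vecPoch_vandermonde v _ 0]
  refine sum_congr rfl fun p hp => ?_
  rw [HasAntidiagonal.mem_antidiagonal] at hp
  rw [vecPoch_t_pow_zero, ← hp, inDim_add, add_dotProduct, pow_add,
    t_zpow_neg_eulerForm_inDim, coeff_series, r_div_gl_eq_inDim, invSeries, coeff_series]
  ring

/-! ### Tuples with a given first entry -/

/-- The part of the series of the Bozec–Schiffmann–Vasserot functions that comes from the tuples
with first entry `x`; the empty tuple has first entry `0`. -/
def headSeries (x : V → ℕ) : CompletedQuantumTorus V :=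
  series fun v => ∑ L ∈ (tuples_finite v).toFinset with L.getD 0 0 = x, tupleTerm L

theorem headSeries_zero : headSeries (0 : V → ℕ) = 1 := by
  funext v
  change ∑ L ∈ (tuples_finite v).toFinset with L.getD 0 0 = 0, tupleTerm L =
    if v = 0 then 1 else 0
  split_ifs with h
  · subst h
    rw [sum_eq_single []]
    · exact tupleTerm_nil
    · intro L hL hne
      rw [mem_filter, Set.Finite.mem_toFinset] at hL
      exact absurd (eq_nil_of_getD_zero_eq_zero hL.1 hL.2) hne
    · intro h
      refine absurd ?_ h
      rw [mem_filter, Set.Finite.mem_toFinset]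
      exact ⟨nil_mem_tuples, rfl⟩
  · refine sum_eq_zero fun L hL => ?_
    rw [mem_filter, Set.Finite.mem_toFinset] at hL
    refine absurd ?_ h
    rw [← sum_of_mem_tuples hL.1, eq_nil_of_getD_zero_eq_zero hL.1 hL.2]
    rfl

theorem coeff_headSeries_of_not_le {x v : V → ℕ} (h : ¬ x ≤ v) : coeff (headSeries x) v = 0 := by
  rw [headSeries, coeff_series]
  refine sum_eq_zero fun L hL => ?_
  rw [mem_filter, Set.Finite.mem_toFinset] at hL
  refine absurd ?_ h
  rw [← hL.2, ← sum_of_mem_tuples hL.1]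
  exact getD_zero_le_sum L

theorem coeff_headSeries_mul_of_not_le {x v : V → ℕ} (h : ¬ x ≤ v)
    (f : CompletedQuantumTorus V) : coeff (headSeries x * f) v = 0 := by
  rw [coeff_mul]
  refine sum_eq_zero fun p hp => ?_
  rw [HasAntidiagonal.mem_antidiagonal] at hp
  have hle : p.1 ≤ v := by
    rw [← hp]
    exact le_self_add
  rw [coeff_headSeries_of_not_le fun hx => h (hx.trans hle), zero_mul, mul_zero]

theorem coeff_headSeries_add {x : V → ℕ} (hx : x ≠ 0) (y : V → ℕ) :
    coeff (headSeries x) (x + y) =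
      (gl x)⁻¹ * (t ^ (-eulerForm x y) *
        ∑ L ∈ (tuples_finite y).toFinset with L.getD 0 0 ∈ Iic (inDim x),
          H x (L.getD 0 0) * tupleTerm L) := by
  rw [mul_sum, mul_sum, headSeries, coeff_series]
  symm
  refine sum_nbij (fun L => x :: L) ?_ ?_ ?_ ?_
  · intro L hL
    rw [mem_filter, Set.Finite.mem_toFinset] at hL ⊢
    have hs := sum_of_mem_tuples hL.1
    exact ⟨cons_mem_tuples_iff.mpr ⟨hx, by rw [hs], mem_Iic.mp hL.2, by rw [hs]; exact hL.1⟩, rfl⟩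
  · intro L _ L' _ h
    exact (List.cons.inj h).2
  · intro L hL
    rw [mem_coe, mem_filter, Set.Finite.mem_toFinset] at hL
    obtain ⟨hL, h0⟩ := hL
    cases L with
    | nil => exact absurd h0.symm hx
    | cons z L =>
      obtain rfl : z = x := h0
      obtain ⟨-, hs, hle, hL⟩ := cons_mem_tuples_iff.mp hL
      rw [add_left_cancel hs] at hL
      refine ⟨L, ?_, rfl⟩
      rw [mem_coe, mem_filter, Set.Finite.mem_toFinset]
      exact ⟨hL, mem_Iic.mpr hle⟩
  · intro L hL
    rw [mem_filter, Set.Finite.mem_toFinset] at hL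
    rw [tupleTerm_cons, sum_of_mem_tuples hL.1]

/-- The recursion for `headSeries` obtained by removing the first entry of a tuple. The sum
is finite, as the second entry is at most `inDim x`. -/
theorem headSeries_eq {x : V → ℕ} (hx : x ≠ 0) :
    headSeries x = (gl x)⁻¹ • (X x * ∑ y ∈ Iic (inDim x), extH x y • headSeries y) := by
  refine coeff_ext fun v => ?_
  rw [coeff_smul]
  by_cases h : x ≤ v
  · obtain ⟨y, rfl⟩ := exists_add_of_le h
    rw [coeff_headSeries_add hx, coeff_X_mul_add, coeff_sum,
      ← sum_fiberwise_of_maps_to (t := Iic (inDim x)) (g := fun L : List (V → ℕ) => L.getD 0 0)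
        (fun L hL => (mem_filter.mp hL).2)]
    congr 2
    refine sum_congr rfl fun z hz => ?_
    rw [coeff_smul, headSeries, coeff_series, mul_sum, filter_filter]
    refine sum_congr ?_ fun L hL => ?_
    · refine filter_congr fun L _ => ⟨fun hL => hL.2, fun hL => ⟨?_, hL⟩⟩
      rw [hL]
      exact hz
    · rw [(mem_filter.mp hL).2, extH_of_le (mem_Iic.mp hz)]
  · rw [coeff_X_mul_of_not_le _ h, mul_zero, coeff_headSeries_of_not_le h]

/-- The series `headSeries x` add up to that of the Bozec–Schiffmann–Vasserot functions; a first
entry is bounded by the sum of its tuple, so that every bound `u ≥ v` may be used in degree `v`. -/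
theorem sum_coeff_headSeries {u v : V → ℕ} (h : v ≤ u) :
    ∑ x ∈ Iic u, coeff (headSeries x) v = n v / gl v := by
  rw [n, mul_div_cancel_left₀ _ (gl_ne_zero v)]
  have hmaps : ∀ L ∈ (tuples_finite v).toFinset, L.getD 0 0 ∈ Iic u := by
    intro L hL
    rw [Set.Finite.mem_toFinset] at hL
    have hle := getD_zero_le_sum L
    rw [sum_of_mem_tuples hL] at hle
    exact mem_Iic.mpr (hle.trans h)
  exact sum_fiberwise_of_maps_to hmaps _

/-! ### The product of the series of the Bozec–Schiffmann–Vasserot functions and its inverse -/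

/-- The formula for the products `headSeries x * invSeries` is compatible with the removal of the
first entry of a tuple. This is the `q`-Vandermonde identity with middle variable `t^{(_•x)_i}`. -/
theorem sum_extH_mul_vecPoch (x v : V → ℕ) :
    ∑ p ∈ antidiagonal v, extH x p.1 *
      ((gl p.1)⁻¹ * ((t ^ (p.1 ⬝ᵥ p.2))⁻¹ * vecPoch p.2 0 1)) =
      (t ^ (inDim x ⬝ᵥ v))⁻¹ * vecPoch v 0 1 := by
  have h := vecPoch_vandermonde v 0 (fun i => t ^ inDim x i) 1
  rw [← h, mul_sum]
  refine sum_congr rfl fun p hp => ?_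
  rw [HasAntidiagonal.mem_antidiagonal] at hp
  have h1 := vecPoch_mul_mul p.2 (inDim x) 0 1
  simp only [Pi.zero_apply, mul_zero, Pi.one_apply, mul_one] at h1
  have h2 := gl_ne_zero p.1
  have h3 : t ^ (inDim x ⬝ᵥ p.2) ≠ 0 := pow_ne_zero _ t_ne_zero
  change _ = _ * (_ * (_ * vecPoch p.2 (fun _ => 0) _))
  rw [h1, ← hp, dotProduct_add, pow_add, mul_inv, extH]
  field_simp

/-- `headSeries x` times `invSeries` has an explicit formula: its coefficient at `x + v` is
`t^{-x·v} / gl(x, t)` times the coefficient of `invSeries` at `v`. The induction is on `v`, as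
removing a non-zero first entry from the tuples lowers the degree. -/
theorem coeff_headSeries_mul_invSeries (x v : V → ℕ) :
    coeff (headSeries x * invSeries V) (x + v) =
      (gl x)⁻¹ * ((t ^ (x ⬝ᵥ v))⁻¹ * vecPoch v 0 1) := by
  have hzero (v : V → ℕ) : coeff (headSeries 0 * invSeries V) (0 + v) =
      (gl (0 : V → ℕ))⁻¹ * ((t ^ ((0 : V → ℕ) ⬝ᵥ v))⁻¹ * vecPoch v 0 1) := by
    rw [headSeries_zero, one_mul, zero_add, invSeries, coeff_series]
    simp
  induction v using WellFoundedLT.induction generalizing x with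
  | ind v ih =>
    by_cases hx : x = 0
    · rw [hx]
      exact hzero v
    rw [headSeries_eq hx, smul_mul_assoc, mul_assoc, coeff_smul, coeff_X_mul_add, sum_mul,
      coeff_sum]
    have key : ∑ y ∈ Iic (inDim x), coeff (extH x y • headSeries y * invSeries V) v =
        (t ^ (inDim x ⬝ᵥ v))⁻¹ * vecPoch v 0 1 := by
      rw [← sum_extH_mul_vecPoch]
      -- The summand vanishes unless both `y ≤ inDim x` and `y ≤ v`.
      rw [sum_subset (Iic_subset_Iic.mpr (le_sup_left : inDim x ≤ inDim x ⊔ v)),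
        ← sum_subset (Iic_subset_Iic.mpr (le_sup_right : v ≤ inDim x ⊔ v)),
        sum_Iic_eq_sum_antidiagonal]
      · refine sum_congr rfl fun p hp => ?_
        rw [HasAntidiagonal.mem_antidiagonal] at hp
        rw [smul_mul_assoc, coeff_smul]
        congr 1
        rw [← hp]
        by_cases h1 : p.1 = 0
        · rw [h1]
          exact hzero p.2
        · refine ih p.2 ?_ p.1
          rw [← hp]
          exact lt_add_of_pos_left _ (pos_iff_ne_zero.mpr h1)
      · intro y _ hy
        rw [smul_mul_assoc, coeff_smul,
          coeff_headSeries_mul_of_not_le fun h => hy (mem_Iic.mpr h), mul_zero]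
      · intro y _ hy
        rw [smul_mul_assoc, coeff_smul,
          extH_eq_zero_of_not_le fun h => hy (mem_Iic.mpr h), zero_mul]
    rw [key, t_zpow_neg_eulerForm_inDim]
    have h3 : t ^ (inDim x ⬝ᵥ v) ≠ 0 := pow_ne_zero _ t_ne_zero
    field_simp

/-- The sum over all first entries `x` of the formula for `headSeries x * invSeries` collapses by
the `q`-Vandermonde identity with outer variables `0` and middle variable `1`. -/
theorem series_n_mul_invSeries :
    (series fun v : V → ℕ => n v / gl v) * invSeries V = 1 := by
  refine coeff_ext fun v => ?_
  have h : coeff ((series fun v : V → ℕ => n v / gl v) * invSeries V) v =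
      ∑ x ∈ Iic v, coeff (headSeries x * invSeries V) v := by
    simp only [coeff_mul]
    rw [sum_comm]
    refine sum_congr rfl fun p hp => ?_
    rw [HasAntidiagonal.mem_antidiagonal] at hp
    have hle : p.1 ≤ v := by
      rw [← hp]
      exact le_self_add
    rw [← mul_sum, ← sum_mul, sum_coeff_headSeries hle, coeff_series]
  rw [h, sum_Iic_eq_sum_antidiagonal, coeff_one, ← vecPoch_zero_zero,
    ← vecPoch_vandermonde v 0 1 0]
  refine sum_congr rfl fun p hp => ?_
  rw [HasAntidiagonal.mem_antidiagonal] at hp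
  rw [← hp, coeff_headSeries_mul_invSeries, vecPoch_one_zero, mul_left_comm]

theorem invSeries_mul_series_n :
    invSeries V * (series fun v : V → ℕ => n v / gl v) = 1 := by
  refine mul_eq_one_symm series_n_mul_invSeries ?_ ?_
  · have h := sum_coeff_headSeries (le_refl (0 : V → ℕ))
    have hIic : Iic (0 : V → ℕ) = {0} := by
      ext x
      simp
    rw [coeff_series, ← h, hIic, sum_singleton, headSeries_zero, coeff_one, if_pos rfl]
  · rw [invSeries, coeff_series, vecPoch_zero]

end Torus

end

end QuiverTorus

theorem mainTheorem3 (V : Type u) [Fintype V] [DecidableEq V] [Quiver.{w + 1} V]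
    [∀ a b : V, Fintype (a ⟶ b)] :
    (QuiverTorus.CompletedQuantumTorus.series fun v : V → ℕ =>
        QuiverTorus.r v / QuiverTorus.gl v) =
      (QuiverTorus.CompletedQuantumTorus.series fun v : V → ℕ =>
        QuiverTorus.m v / QuiverTorus.gl v) *
      (QuiverTorus.CompletedQuantumTorus.series fun v : V → ℕ =>
        QuiverTorus.n v / QuiverTorus.gl v) ∧
    (QuiverTorus.CompletedQuantumTorus.series fun v : V → ℕ =>
        QuiverTorus.r v / QuiverTorus.gl v) =
      (QuiverTorus.CompletedQuantumTorus.series fun v : V → ℕ =>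
        QuiverTorus.n v / QuiverTorus.gl v) *
      (QuiverTorus.CompletedQuantumTorus.series fun v : V → ℕ =>
        QuiverTorus.e v / QuiverTorus.gl v) := by
  constructor
  · rw [← QuiverTorus.series_r_mul_invSeries, mul_assoc, QuiverTorus.invSeries_mul_series_n,
      mul_one]
  · rw [← QuiverTorus.invSeries_mul_series_r, ← mul_assoc, QuiverTorus.series_n_mul_invSeries,
      one_mul]
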